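/- Let $p$ be a prime, $m\ge 1$ and $n \ge 0$ integers, and $S_n$ the symmetric group. Let $\sim_m^{comb}$ be the equivalence relation on partitions of $n$ generated by $\lambda\sim_m^{comb}\mu$ whenever $\mu$ is formed from $\lambda$ by replacing $p^m$ parts of some size $k$ with $p^{m-1}$ parts of size $kp$; for $\sigma,\sigma'\in S_n$ write $\sigma\sim_m^{comb}\sigma'$ if the cycle types of $\sigma$ and $\sigma'$ (partitions of $n$, fixed points counted as parts of size $1$) are related in this way. Let $\sim_m$ be the equivalence relation on $S_n$ generated by conjugation and by $g\sim_m gh^{p^{m-1}}$ whenever $h$ commutes with $g$ and has order a power of $p$. Then for all $\sigma,\sigma'\in S_n$ the following are equivalent: (i) $\sigma\sim_m^{comb}\sigma'$; (ii) $\sigma\sim_m\sigma'$; (iii) $\chi(\sigma)\equiv\chi(\sigma') \pmod{p^m}$ for all complex characters $\chi$ of $S_n$ (their values are rational integers, and the congruence is one of integers). -/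

import Mathlib

/-- One generating step of the combinatorial relation on partitions of `N`: `μ` is formed from `ν`
by replacing `p ^ m` parts of size `k` with `p ^ (m - 1)` parts of size `k * p`, the remaining
parts `ξ` being unchanged (`k` is a part, hence positive; used for `1 ≤ m` only). -/
def PartsReplacement (p m : ℕ) {N : ℕ} (ν μ : N.Partition) : Prop :=
  ∃ (ξ : Multiset ℕ) (k : ℕ),
    ν.parts = ξ + Multiset.replicate (p ^ m) k ∧
    μ.parts = ξ + Multiset.replicate (p ^ (m - 1)) (k * p)

/-- The combinatorial relation on partitions of `N`: the equivalence relation generated by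
`PartsReplacement p m`. -/
def PartitionCombRel (p m : ℕ) {N : ℕ} (ν μ : N.Partition) : Prop :=
  Relation.EqvGen (PartsReplacement p m) ν μ

/-- The combinatorial relation on permutations: their cycle types, as partitions of `n` that
include the fixed points as parts `1`, are related by `PartitionCombRel p m`. -/
def PermCombRel (p m : ℕ) {n : ℕ} (σ τ : Equiv.Perm (Fin n)) : Prop :=
  PartitionCombRel p m σ.partition τ.partition

/-- The relation `∼_m` on a group (used for `1 ≤ m` only): the equivalence relation generated by
conjugation and by `g ∼ g * h ^ (p ^ (m - 1))` whenever `h` commutes with `g` and the order of `h`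
is a power of `p`. -/
def GroupPrimePowerRel (p m : ℕ) {G : Type*} [Group G] (g g' : G) : Prop :=
  Relation.EqvGen
    (fun x y : G => IsConj x y ∨
      ∃ h : G, Commute h x ∧ (∃ a : ℕ, orderOf h = p ^ a) ∧ y = x * h ^ (p ^ (m - 1)))
    g g'

/-- `χ` is a complex character of `G`: the trace function of a finite-dimensional complex
representation of `G` (each of which is isomorphic to one on a space in `Type`). -/
def IsComplexCharacter {G : Type*} [Group G] (χ : G → ℂ) : Prop :=
  ∃ (V : Type) (_ : AddCommGroup V) (_ : Module ℂ V) (_ : FiniteDimensional ℂ V)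
    (ρ : Representation ℂ G V), χ = ρ.character

/-- Congruence of two complex numbers modulo the natural number `N` as rational integers: both are
integers, and they are congruent modulo `N`. -/
def IntCongruentMod (N : ℕ) (z w : ℂ) : Prop :=
  ∃ a b : ℤ, z = (a : ℂ) ∧ w = (b : ℂ) ∧ a ≡ b [ZMOD (N : ℤ)]

/-! (i) ⇒ (ii): Write `k = p ^ a * k'` with `p ∤ k'` and let `c` be a cycle of length `p ^ m * k`.
Then `c ^ p ^ m` has `p ^ m` cycles of length `k`. Multiplying it by the `p ^ (m - 1)`-th power of
the `p`-element `c ^ k'` gives a permutation with `p ^ (m - 1)` cycles of length `k * p`.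

(ii) ⇒ (iii): In a symmetric group `σ ^ u` is conjugate to `σ` for `u` coprime to the order, so
characters do not see coprime powers. Pulled back to the abelian group `⟨x⟩ × ⟨h⟩`, such a character
has equal multiplicities at all generators of a cyclic subgroup of the dual. Its values are
therefore integral combinations of Ramanujan sums, and `ramanujanInt_mul_pow_modEq` gives the
congruence for each of these.

(iii) ⇒ (i): Replacements bring every partition to one with all multiplicities below `p ^ m`. The
permutation character on `k`-subsets is the coefficient of `X ^ k` in `∏ (1 + X ^ i)` over the parts
`i`. Modulo `p ^ m` these coefficients determine the multiplicities recursively, hence the reduced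
partition. -/

/-! ### Ramanujan sums and their congruences -/

/-- The Ramanujan-type sum attached to an element `w` with `w ^ M = 1`, in its divisor form. -/
noncomputable def ramanujanInt {K : Type*} [Field K] (M : ℕ) (w : K) : ℤ :=
  open Classical in
  ∑ e ∈ M.divisors, ArithmeticFunction.moebius e * ((M / e : ℕ) : ℤ) * if w ^ e = 1 then 1 else 0

theorem sum_divisors_gcd_moebius {M : ℕ} (hM : 0 < M) (u : ℕ) :
    ∑ e ∈ M.divisors with e ∣ u, ArithmeticFunction.moebius e =
      if M.Coprime u then 1 else 0 := by
  have h1 : {e ∈ M.divisors | e ∣ u} = (M.gcd u).divisors := by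
    ext e
    have : M.gcd u ≠ 0 := (Nat.gcd_pos_of_pos_left u hM).ne'
    simp [Nat.dvd_gcd_iff, hM.ne', this]
  have h2 := congrArg (fun f => f (M.gcd u)) ArithmeticFunction.coe_zeta_mul_moebius
  simp only [ArithmeticFunction.coe_zeta_mul_apply, ArithmeticFunction.one_apply] at h2
  rw [h1, h2]

theorem sum_pow_filter_dvd {K : Type*} [Field K] [DecidableEq K] {M e : ℕ} (hM : 0 < M)
    (he : e ∣ M) {w : K} (hw : w ^ M = 1) :
    ∑ u ∈ Finset.range M with e ∣ u, w ^ u = if w ^ e = 1 then ((M / e : ℕ) : K) else 0 := by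
  obtain ⟨d, rfl⟩ := he
  have he0 : 0 < e := Nat.pos_of_mul_pos_right hM
  rw [Nat.mul_div_cancel_left d he0]
  have h1 : ∑ u ∈ Finset.range (e * d) with e ∣ u, w ^ u = ∑ j ∈ Finset.range d, (w ^ e) ^ j := by
    symm
    refine Finset.sum_bij (fun j _ => e * j) ?_ ?_ ?_ ?_
    · intro j hj
      simp only [Finset.mem_filter, Finset.mem_range] at hj ⊢
      exact ⟨Nat.mul_lt_mul_of_pos_left hj he0, dvd_mul_right e j⟩
    · intro a _ b _ h
      exact Nat.eq_of_mul_eq_mul_left he0 h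
    · intro b hb
      simp only [Finset.mem_filter, Finset.mem_range] at hb
      obtain ⟨hb, j, rfl⟩ := hb
      exact ⟨j, Finset.mem_range.2 (lt_of_mul_lt_mul_left hb e.zero_le), rfl⟩
    · intro j _
      rw [pow_mul]
  rw [h1]
  split_ifs with h
  · simp [h]
  · have h2 := mul_geom_sum (w ^ e) d
    rw [← pow_mul, hw, sub_self] at h2
    exact (mul_eq_zero.1 h2).resolve_left (sub_ne_zero.2 h)

/-- Möbius inversion of the coprimality condition leaves geometric sums over the multiples of each
divisor `e`, which vanish unless `w ^ e = 1`. -/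
theorem sum_pow_coprime_eq_ramanujanInt {K : Type*} [Field K] {M : ℕ} (hM : 0 < M) {w : K}
    (hw : w ^ M = 1) :
    ∑ u ∈ Finset.range M with M.Coprime u, w ^ u = (ramanujanInt M w : K) := by
  classical
  calc ∑ u ∈ Finset.range M with M.Coprime u, w ^ u
      = ∑ u ∈ Finset.range M, ∑ e ∈ M.divisors,
          if e ∣ u then (ArithmeticFunction.moebius e : K) * w ^ u else 0 := by
        rw [Finset.sum_filter]
        refine Finset.sum_congr rfl fun u _ => ?_
        have h := congrArg (fun z : ℤ => (z : K) * w ^ u) (sum_divisors_gcd_moebius hM u)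
        simp only [Int.cast_sum, Finset.sum_mul] at h
        rw [← Finset.sum_filter, h]
        split_ifs <;> simp
    _ = ∑ e ∈ M.divisors, (ArithmeticFunction.moebius e : K) *
          ∑ u ∈ Finset.range M with e ∣ u, w ^ u := by
        rw [Finset.sum_comm]
        refine Finset.sum_congr rfl fun e _ => ?_
        rw [← Finset.sum_filter, Finset.mul_sum]
    _ = (ramanujanInt M w : K) := by
        rw [ramanujanInt, Int.cast_sum]
        refine Finset.sum_congr rfl fun e he => ?_
        rw [sum_pow_filter_dvd hM (Nat.dvd_of_mem_divisors he) hw]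
        split_ifs <;>
          simp only [Int.cast_mul, Int.cast_natCast, Int.cast_zero, mul_one, mul_zero]

/-- The congruence holds term by term. Only squarefree `e` count, so `p` divides `e` at most once.
If `p ^ m ∣ M / e`, both terms vanish modulo `p ^ m`; otherwise the `p`-part of `M` divides `p ^ (m
- 1) * e`, and the factor `v` drops out of the condition `w ^ e = 1`. -/
theorem ramanujanInt_mul_pow_modEq {K : Type*} [Field K] {p m M a : ℕ} (hp : p.Prime) (hm : 1 ≤ m)
    (hM : 0 < M) (w : K) {v : K} (hv : v ^ M = 1) (hva : v ^ p ^ a = 1) :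
    ramanujanInt M w ≡ ramanujanInt M (w * v ^ p ^ (m - 1)) [ZMOD (p ^ m : ℕ)] := by
  classical
  obtain ⟨s, M', hM', rfl⟩ := Nat.exists_eq_pow_mul_and_not_dvd hM.ne' p hp.ne_one
  have hvs : v ^ p ^ s = 1 := by
    have h1 := pow_gcd_eq_one.2 ⟨hv, hva⟩
    have h2 : (p ^ s * M').gcd (p ^ a) ∣ p ^ s := by
      have : Nat.Coprime ((p ^ s * M').gcd (p ^ a)) M' :=
        Nat.Coprime.coprime_dvd_left (Nat.gcd_dvd_right _ _)
          (Nat.Coprime.pow_left a ((Nat.Prime.coprime_iff_not_dvd hp).2 hM'))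
      exact this.dvd_of_dvd_mul_right (Nat.gcd_dvd_left _ _)
    obtain ⟨c, hc⟩ := h2
    rw [hc, pow_mul, h1, one_pow]
  unfold ramanujanInt
  refine Int.ModEq.sum fun e he => ?_
  have heM := Nat.dvd_of_mem_divisors he
  by_cases hsq : Squarefree e
  swap
  · simp [ArithmeticFunction.moebius_eq_zero_of_not_squarefree hsq]
  have he0 : e ≠ 0 := hsq.ne_zero
  obtain ⟨r, e', he', rfl⟩ := Nat.exists_eq_pow_mul_and_not_dvd he0 p hp.ne_one
  have hr : r ≤ 1 := by
    by_contra hr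
    have : p * p ∣ p ^ r * e' := by
      rw [← pow_two]
      exact (pow_dvd_pow p (by omega)).mul_right e'
    exact hp.not_isUnit (hsq p this)
  have hrs : r ≤ s := by
    have h1 : p ^ r ∣ p ^ s * M' := (dvd_mul_right _ _).trans heM
    have h2 : (p ^ r).Coprime M' := Nat.Coprime.pow_left r ((Nat.Prime.coprime_iff_not_dvd hp).2 hM')
    exact (Nat.pow_dvd_pow_iff_le_right hp.one_lt).1 (h2.dvd_of_dvd_mul_right h1)
  have he'M : e' ∣ M' := by
    have h1 : e' ∣ p ^ s * M' := (dvd_mul_left _ _).trans heM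
    exact (Nat.Coprime.pow_right s
      ((Nat.Prime.coprime_iff_not_dvd hp).2 he').symm).dvd_of_dvd_mul_left h1
  by_cases hc : m ≤ s - r
  · have hd : ((p ^ m : ℕ) : ℤ) ∣ ((p ^ s * M' / (p ^ r * e') : ℕ) : ℤ) := by
      rw [Int.natCast_dvd_natCast, ← Nat.div_mul_div_comm (pow_dvd_pow p hrs) he'M,
        Nat.pow_div hrs hp.pos]
      exact (pow_dvd_pow p hc).mul_right _
    exact (Int.modEq_zero_iff_dvd.2 ((hd.mul_left _).mul_right _)).trans
      (Int.modEq_zero_iff_dvd.2 ((hd.mul_left _).mul_right _)).symm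
  · have : (w * v ^ p ^ (m - 1)) ^ (p ^ r * e') = w ^ (p ^ r * e') := by
      obtain ⟨t, ht⟩ : p ^ s ∣ p ^ (m - 1) * (p ^ r * e') := by
        rw [← mul_assoc, ← pow_add]
        exact (pow_dvd_pow p (by omega)).mul_right _
      rw [mul_pow, ← pow_mul v, ht, pow_mul v, hvs, one_pow, mul_one]
    rw [this]

/-! ### Fourier analysis on a finite abelian group -/

open Finset in
/-- A sum weighted by a function that is constant on the generators of each cyclic subgroup,
regrouped along representatives of the cyclic subgroups. -/
theorem exists_sum_eq_sum_coprime_pow {Γ : Type*} [CommGroup Γ] [Fintype Γ] [DecidableEq Γ] :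
    ∃ S : Finset Γ, ∀ (c F : Γ → ℂ),
      (∀ ψ φ : Γ, Subgroup.zpowers ψ = Subgroup.zpowers φ → c ψ = c φ) →
      ∑ ψ, c ψ * F ψ =
        ∑ ψ ∈ S, c ψ * ∑ u ∈ range (orderOf ψ) with (orderOf ψ).Coprime u, F (ψ ^ u) := by
  let s : Setoid Γ := Setoid.ker (fun ψ : Γ => Subgroup.zpowers ψ)
  let r : Γ → Γ := fun ψ => (Quotient.mk s ψ).out
  have hr : ∀ ψ, Subgroup.zpowers (r ψ) = Subgroup.zpowers ψ := fun ψ => Quotient.mk_out (s := s) ψ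
  have hr2 : ∀ ψ φ, Subgroup.zpowers ψ = Subgroup.zpowers φ → r ψ = r φ := by
    intro ψ φ h
    exact congrArg Quotient.out (Quotient.sound (s := s) h)
  refine ⟨univ.image r, fun c F hc => ?_⟩
  rw [← sum_fiberwise_of_maps_to (t := univ.image r) (g := r)
    (fun ψ _ => mem_image_of_mem r (mem_univ ψ))]
  refine sum_congr rfl fun ψ hψ => ?_
  obtain ⟨φ, -, rfl⟩ := mem_image.1 hψ
  have hrr : r (r φ) = r φ := hr2 _ _ (hr φ)
  rw [mul_sum]
  symm
  -- The generators of a cyclic group are the powers of one generator with exponent coprime to its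
  -- order.
  refine sum_bij (fun u _ => r φ ^ u) ?_ ?_ ?_ ?_
  · intro u hu
    simp only [mem_filter, mem_range, mem_univ, true_and] at hu ⊢
    rw [← hrr]
    refine hr2 _ _ (le_antisymm ?_ ?_)
    · rw [Subgroup.zpowers_le, hrr]
      exact Subgroup.npow_mem_zpowers _ _
    · rw [Subgroup.zpowers_le, hrr]
      exact mem_zpowers_pow_iff.2 hu.2.symm
  · intro a ha b hb h
    simp only [mem_filter, mem_range] at ha hb
    exact pow_injOn_Iio_orderOf (Set.mem_Iio.2 ha.1) (Set.mem_Iio.2 hb.1) h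
  · intro ψ h
    simp only [mem_filter, mem_univ, true_and] at h
    have h1 : ψ ∈ Subgroup.zpowers (r φ) := by
      rw [← h, hr]
      exact Subgroup.mem_zpowers ψ
    rw [mem_zpowers_iff_mem_range_orderOf, mem_image] at h1
    obtain ⟨u, hu, rfl⟩ := h1
    refine ⟨u, mem_filter.2 ⟨hu, ?_⟩, rfl⟩
    refine Nat.Coprime.symm (mem_zpowers_pow_iff.1 ?_)
    rw [← hr (r φ ^ u), h]
    exact Subgroup.mem_zpowers _
  · intro u hu
    simp only [mem_filter, mem_range] at hu
    congr 1
    refine hc _ _ (le_antisymm ?_ ?_)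
    · rw [Subgroup.zpowers_le]
      exact mem_zpowers_pow_iff.2 hu.2.symm
    · rw [Subgroup.zpowers_le]
      exact Subgroup.npow_mem_zpowers _ _

section Fourier

variable {A V : Type*} [CommGroup A] [AddCommGroup V] [Module ℂ V]

/-- The twist of a representation of a commutative group by the inverse of a linear character. -/
noncomputable def Representation.invTwist (ρ : Representation ℂ A V)
    (ψ : AddChar (Additive A) ℂ) : Representation ℂ A V :=
  { toFun := fun a => ψ (-Additive.ofMul a) • ρ a
    map_one' := by simp
    map_mul' := fun a b => by
      rw [map_mul ρ, ofMul_mul, neg_add, AddChar.map_add_eq_mul, smul_mul_smul_comm] }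

/-- The multiplicity of a linear character in a representation of a commutative group. -/
noncomputable def Representation.charMultiplicity (ρ : Representation ℂ A V)
    (ψ : AddChar (Additive A) ℂ) : ℕ :=
  Module.finrank ℂ (ρ.invTwist ψ).invariants

variable [Fintype A] [FiniteDimensional ℂ V] (ρ : Representation ℂ A V)

theorem Representation.charMultiplicity_eq (ψ : AddChar (Additive A) ℂ) :
    (ρ.charMultiplicity ψ : ℂ) =
      (Nat.card A : ℂ)⁻¹ * ∑ a : A, ψ (-Additive.ofMul a) * ρ.character a := by
  have : Invertible (Nat.card A : ℂ) := invertibleOfNonzero (Nat.cast_ne_zero.2 Nat.card_pos.ne')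
  rw [charMultiplicity, ← card_inv_mul_sum_char_eq_finrank]
  congr 1
  refine Finset.sum_congr rfl fun a _ => ?_
  simp [invTwist, character]

theorem Representation.character_eq_sum_charMultiplicity (z : A) :
    ρ.character z = ∑ ψ : AddChar (Additive A) ℂ,
      (ρ.charMultiplicity ψ : ℂ) * ψ (Additive.ofMul z) := by
  classical
  simp_rw [charMultiplicity_eq, mul_assoc, Finset.sum_mul]
  rw [← Finset.mul_sum, Finset.sum_comm]
  have : ∀ a : A, ∑ ψ : AddChar (Additive A) ℂ,
      ψ (-Additive.ofMul a) * ρ.character a * ψ (Additive.ofMul z) =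
      if a = z then (Nat.card A : ℂ) * ρ.character a else 0 := by
    intro a
    have h := AddChar.sum_apply_eq_ite (-Additive.ofMul a + Additive.ofMul z)
    simp_rw [AddChar.map_add_eq_mul] at h
    have h2 : -Additive.ofMul a + Additive.ofMul z = 0 ↔ a = z := by
      rw [neg_add_eq_zero, Additive.ofMul.injective.eq_iff]
    simp_rw [h2] at h
    calc _ = (∑ ψ : AddChar (Additive A) ℂ,
        ψ (-Additive.ofMul a) * ψ (Additive.ofMul z)) * ρ.character a := by
          rw [Finset.sum_mul]
          exact Finset.sum_congr rfl fun ψ _ => by ring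
      _ = _ := by
          rw [h, ite_mul, zero_mul, ← Nat.card_eq_fintype_card, Nat.card_congr Additive.toMul]
  simp_rw [this]
  rw [Finset.sum_ite_eq' Finset.univ z]
  simp

variable {ρ}

/-- In the averaging formula for the multiplicity, substitute `a ↦ a ^ u`, a bijection of `A`. -/
theorem Representation.charMultiplicity_pow
    (hρ : ∀ (g : A) (u : ℕ), (Nat.card A).Coprime u → ρ.character (g ^ u) = ρ.character g)
    (ψ : AddChar (Additive A) ℂ) {u : ℕ} (hu : (Nat.card A).Coprime u) :
    ρ.charMultiplicity (ψ ^ u) = ρ.charMultiplicity ψ := by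
  rw [← Nat.cast_inj (R := ℂ), charMultiplicity_eq, charMultiplicity_eq]
  congr 1
  refine Fintype.sum_equiv (powCoprime hu) _ _ fun a => ?_
  rw [powCoprime_apply, hρ a u hu, ofMul_pow, ← smul_neg, AddChar.map_nsmul_eq_pow,
    AddChar.pow_apply]

theorem Representation.charMultiplicity_congr
    (hρ : ∀ (g : A) (u : ℕ), (Nat.card A).Coprime u → ρ.character (g ^ u) = ρ.character g)
    {ψ φ : AddChar (Additive A) ℂ} (h : Subgroup.zpowers ψ = Subgroup.zpowers φ) :
    ρ.charMultiplicity ψ = ρ.charMultiplicity φ := by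
  classical
  have hA : φ ^ Nat.card A = 1 := by
    ext a
    have h0 : Nat.card A • a = 0 := by
      rw [Nat.card_congr (Additive.ofMul (α := A)), card_nsmul_eq_zero']
    rw [AddChar.pow_apply, ← AddChar.map_nsmul_eq_pow, h0, AddChar.map_zero_eq_one,
      AddChar.one_apply]
  have hd : orderOf φ ∣ Nat.card A := orderOf_dvd_of_pow_eq_one hA
  have h1 : ψ ∈ Subgroup.zpowers φ := h ▸ Subgroup.mem_zpowers ψ
  rw [mem_zpowers_iff_mem_range_orderOf, Finset.mem_image] at h1
  obtain ⟨u, -, rfl⟩ := h1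
  have hc : u.Coprime (orderOf φ) := mem_zpowers_pow_iff.1 (h ▸ Subgroup.mem_zpowers φ)
  have : NeZero (Nat.card A) := ⟨Nat.card_pos.ne'⟩
  -- The exponent `u` is coprime only to the order of `φ`; it is lifted to one coprime to the order
  -- of `A`, as the invariance hypothesis requires.
  obtain ⟨v, hv⟩ := ZMod.unitsMap_surjective hd (ZMod.unitOfCoprime u hc)
  have hvu : φ ^ (v : ZMod (Nat.card A)).val = φ ^ u := by
    rw [pow_eq_pow_iff_modEq, ← ZMod.natCast_eq_natCast_iff]
    have h3 := congrArg Units.val hv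
    rw [ZMod.coe_unitOfCoprime, ZMod.unitsMap_val] at h3
    rw [← h3, ZMod.natCast_val]
  rw [← hvu]
  exact charMultiplicity_pow hρ φ (ZMod.val_coe_unit_coprime v).symm

/-- The values of a character of a finite commutative group that is invariant under coprime powers
are combinations of Ramanujan sums. -/
theorem Representation.exists_character_eq_sum_ramanujanInt
    (hρ : ∀ (g : A) (u : ℕ), (Nat.card A).Coprime u → ρ.character (g ^ u) = ρ.character g) :
    ∃ S : Finset (AddChar (Additive A) ℂ), ∀ z : A,
      ρ.character z = ((∑ ψ ∈ S, (ρ.charMultiplicity ψ : ℤ) *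
        ramanujanInt (orderOf ψ) (ψ (Additive.ofMul z)) : ℤ) : ℂ) := by
  obtain ⟨S, hS⟩ := exists_sum_eq_sum_coprime_pow (Γ := AddChar (Additive A) ℂ)
  refine ⟨S, fun z => ?_⟩
  rw [character_eq_sum_charMultiplicity, hS (fun ψ => (ρ.charMultiplicity ψ : ℂ))
    (fun ψ => ψ (Additive.ofMul z)) (fun ψ φ h => by rw [charMultiplicity_congr hρ h]),
    Int.cast_sum]
  refine Finset.sum_congr rfl fun ψ _ => ?_
  have h1 : ψ (Additive.ofMul z) ^ orderOf ψ = 1 := by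
    rw [← AddChar.pow_apply, pow_orderOf_eq_one, AddChar.one_apply]
  rw [Int.cast_mul, Int.cast_natCast, ← sum_pow_coprime_eq_ramanujanInt (orderOf_pos ψ) h1]
  simp_rw [AddChar.pow_apply]

end Fourier

/-! ### Congruences for characters invariant under coprime powers -/

/-- If the values of a character of a finite group are invariant under coprime powers, they are
integers, and multiplication by the `p ^ (m - 1)`-th power of a commuting element of `p`-power order
does not change them modulo `p ^ m`. -/
theorem Representation.intCongruentMod_character_mul_pow {G V : Type*} [Group G] [Finite G]
    [AddCommGroup V] [Module ℂ V] [FiniteDimensional ℂ V] (ρ : Representation ℂ G V)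
    (hρ : ∀ (g : G) (u : ℕ), (orderOf g).Coprime u → ρ.character (g ^ u) = ρ.character g)
    {p m a : ℕ} (hp : p.Prime) (hm : 1 ≤ m) {x h : G} (hx : Commute x h)
    (ha : h ^ p ^ a = 1) :
    IntCongruentMod (p ^ m) (ρ.character x) (ρ.character (x * h ^ p ^ (m - 1))) := by
  -- The external product is abelian and maps onto the subgroup generated by `x` and `h`, because
  -- these commute.
  let A := Subgroup.zpowers x × Subgroup.zpowers h
  let _ : CommGroup A :=
    { (inferInstance : Group A) with
      mul_comm := fun a b => Prod.ext (mul_comm' a.1 b.1) (mul_comm' a.2 b.2) }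
  have : Fintype A := Fintype.ofFinite A
  let f : A →* G := MonoidHom.noncommCoprod (Subgroup.zpowers x).subtype
    (Subgroup.zpowers h).subtype (by
      rintro ⟨_, i, rfl⟩ ⟨_, j, rfl⟩
      exact hx.zpow_zpow i j)
  let ρ' : Representation ℂ A V := ρ.comp f
  have hρ' : ∀ z, ρ'.character z = ρ.character (f z) := fun z => rfl
  obtain ⟨S, hS⟩ := exists_character_eq_sum_ramanujanInt (A := A) (ρ := ρ') (by
    intro g u hu
    rw [hρ', hρ', map_pow]
    refine hρ _ _ (Nat.Coprime.coprime_dvd_left ?_ hu)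
    exact (orderOf_map_dvd f g).trans (orderOf_dvd_natCard g))
  let X : A := (⟨x, Subgroup.mem_zpowers x⟩, 1)
  let H : A := (1, ⟨h, Subgroup.mem_zpowers h⟩)
  have hX : f X = x := mul_one x
  have hH : f H = h := one_mul h
  have hHa : H ^ p ^ a = 1 :=
    Prod.ext (one_pow (p ^ a)) (Subtype.ext ha)
  have e1 := hS X
  have e2 := hS (X * H ^ p ^ (m - 1))
  rw [hρ', hX] at e1
  rw [hρ', map_mul, map_pow, hX, hH] at e2
  refine ⟨_, _, e1, e2, Int.ModEq.sum fun ψ _ => Int.ModEq.mul_left _ ?_⟩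
  rw [ofMul_mul, ofMul_pow, AddChar.map_add_eq_mul, AddChar.map_nsmul_eq_pow]
  refine ramanujanInt_mul_pow_modEq (a := a) hp hm (orderOf_pos ψ) _ ?_ ?_
  · rw [← AddChar.pow_apply, pow_orderOf_eq_one, AddChar.one_apply]
  · rw [← AddChar.map_nsmul_eq_pow, ← ofMul_pow, hHa, ofMul_one, AddChar.map_zero_eq_one]

/-! ### Cycles, invariant subsets and permutation characters -/

namespace Equiv.Perm

variable {α : Type*} [Fintype α] [DecidableEq α]

/-- The cycle of `σ` through `x`, as a set of points (a singleton when `x` is fixed). -/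
def cycleSet (σ : Perm α) (x : α) : Finset α := {y | σ.SameCycle x y}

/-- The partition of the underlying type into the cycles of `σ`, fixed points included. -/
def cycleSets (σ : Perm α) : Finset (Finset α) := Finset.univ.image σ.cycleSet

theorem mem_cycleSet {σ : Perm α} {x y : α} : y ∈ σ.cycleSet x ↔ σ.SameCycle x y := by
  simp [cycleSet]

theorem mem_cycleSets {σ : Perm α} {s : Finset α} : s ∈ σ.cycleSets ↔ ∃ x, σ.cycleSet x = s := by
  simp [cycleSets]

theorem cycleSet_eq_of_mem {σ : Perm α} {x y : α} (h : y ∈ σ.cycleSet x) :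
    σ.cycleSet y = σ.cycleSet x := by
  ext z
  rw [mem_cycleSet] at h
  rw [mem_cycleSet, mem_cycleSet]
  exact ⟨h.trans, h.symm.trans⟩

theorem cycleSet_of_apply_eq {σ : Perm α} {x : α} (h : σ x = x) : σ.cycleSet x = {x} := by
  ext y
  rw [mem_cycleSet, Finset.mem_singleton]
  refine ⟨?_, ?_⟩
  · rintro ⟨i, rfl⟩
    exact zpow_apply_eq_self_of_apply_eq_self h i
  · rintro rfl
    exact SameCycle.refl _ _

theorem cycleSet_of_apply_ne {σ : Perm α} {x : α} (h : σ x ≠ x) :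
    σ.cycleSet x = (σ.cycleOf x).support := by
  ext y
  rw [mem_cycleSet, mem_support_cycleOf_iff' h]

theorem map_card_cycleSets (σ : Perm α) :
    σ.cycleSets.val.map Finset.card = σ.partition.parts := by
  have hinj : Set.InjOn support (σ.cycleFactorsFinset : Set (Perm α)) := by
    intro f hf g hg hfg
    obtain ⟨x, hx⟩ := (mem_cycleFactorsFinset_iff.1 hf).1.nonempty_support
    rw [cycle_is_cycleOf hx hf, cycle_is_cycleOf (hfg ▸ hx) hg]
  have hdisj : _root_.Disjoint (σ.cycleFactorsFinset.image support)
      (σ.supportᶜ.image fun x => ({x} : Finset α)) := by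
    rw [Finset.disjoint_left]
    intro s hs hs'
    obtain ⟨f, hf, rfl⟩ := Finset.mem_image.1 hs
    obtain ⟨x, hx, h⟩ := Finset.mem_image.1 hs'
    have h2 := (mem_cycleFactorsFinset_iff.1 hf).1.two_le_card_support
    rw [← h, Finset.card_singleton] at h2
    omega
  have hunion : σ.cycleSets = (σ.cycleFactorsFinset.image support).disjUnion
      (σ.supportᶜ.image fun x => ({x} : Finset α)) hdisj := by
    ext s
    rw [mem_cycleSets, Finset.mem_disjUnion, Finset.mem_image, Finset.mem_image]
    constructor
    · rintro ⟨x, rfl⟩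
      by_cases h : σ x = x
      · exact Or.inr ⟨x, by simpa using h, (cycleSet_of_apply_eq h).symm⟩
      · exact Or.inl ⟨σ.cycleOf x, cycleOf_mem_cycleFactorsFinset_iff.2 (mem_support.2 h),
          (cycleSet_of_apply_ne h).symm⟩
    · rintro (⟨f, hf, rfl⟩ | ⟨x, hx, rfl⟩)
      · obtain ⟨x, hx⟩ := (mem_cycleFactorsFinset_iff.1 hf).1.nonempty_support
        refine ⟨x, ?_⟩
        have hx' : σ x ≠ x :=
          mem_support.1 (mem_cycleFactorsFinset_support_le hf hx)
        rw [cycleSet_of_apply_ne hx', ← cycle_is_cycleOf hx hf]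
      · exact ⟨x, cycleSet_of_apply_eq (by simpa using hx)⟩
  rw [hunion, Finset.disjUnion_val, Multiset.map_add, parts_partition, Finset.image_val_of_injOn hinj,
    Finset.image_val_of_injOn Finset.singleton_injective.injOn, Multiset.map_map, Multiset.map_map,
    cycleType_def]
  congr 1
  rw [Multiset.eq_replicate]
  refine ⟨?_, fun b hb => ?_⟩
  · rw [Multiset.card_map, Finset.card_val, Finset.card_compl]
  · obtain ⟨x, -, rfl⟩ := Multiset.mem_map.1 hb
    simp

/-- Each of `σ` and `σ ^ u` is a power of the other, so they have the same orbits, and the orbit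
sizes determine the conjugacy class. -/
theorem isConj_pow_of_coprime {σ : Perm α} {u : ℕ} (hu : (orderOf σ).Coprime u) :
    IsConj (σ ^ u) σ := by
  obtain ⟨v, hv⟩ := exists_pow_eq_self_of_coprime hu.symm
  have h : (σ ^ u).cycleSet = σ.cycleSet := by
    ext x y
    rw [mem_cycleSet, mem_cycleSet]
    constructor
    · rintro ⟨i, rfl⟩
      exact ⟨u * i, by rw [zpow_mul, zpow_natCast]⟩
    · rintro ⟨i, rfl⟩
      exact ⟨v * i, by rw [zpow_mul, zpow_natCast, hv]⟩
  rw [partition_eq_of_isConj, Nat.Partition.ext_iff, ← map_card_cycleSets, ← map_card_cycleSets,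
    cycleSets, cycleSets, h]

theorem pairwiseDisjoint_cycleSets (σ : Perm α) :
    (σ.cycleSets : Set (Finset α)).PairwiseDisjoint id := by
  intro s hs t ht hst
  obtain ⟨x, rfl⟩ := mem_cycleSets.1 hs
  obtain ⟨y, rfl⟩ := mem_cycleSets.1 ht
  refine Finset.disjoint_left.2 fun z hz hz' => hst ?_
  rw [← cycleSet_eq_of_mem hz, cycleSet_eq_of_mem hz']

open scoped Pointwise

theorem cycleSet_subset_of_smul_eq {σ : Perm α} {T : Finset α} (hT : σ • T = T) {x : α}
    (hx : x ∈ T) : σ.cycleSet x ⊆ T := by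
  intro y hy
  obtain ⟨i, rfl⟩ := mem_cycleSet.1 hy
  have h : σ ^ i • T = T := by
    have : σ ∈ MulAction.stabilizer (Perm α) T := hT
    exact zpow_mem this i
  rw [← h]
  exact Finset.smul_mem_smul_finset hx

open Polynomial in
/-- The generating function of the subsets invariant under a permutation, by cardinality. -/
theorem sum_X_pow_card_invariant (σ : Perm α) :
    ∑ T : Finset α with σ • T = T, (X : ℤ[X]) ^ T.card =
      (σ.partition.parts.map fun i => 1 + (X : ℤ[X]) ^ i).prod := by
  rw [← map_card_cycleSets, Multiset.map_map]
  change _ = ∏ c ∈ σ.cycleSets, (1 + (X : ℤ[X]) ^ c.card)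
  rw [Finset.prod_one_add]
  symm
  -- Invariant subsets are exactly the unions of sets of cycles.
  refine Finset.sum_bij (fun S _ => S.biUnion id) ?_ ?_ ?_ ?_
  · intro S hS
    rw [Finset.mem_powerset] at hS
    rw [Finset.mem_filter]
    refine ⟨Finset.mem_univ _, ?_⟩
    refine Finset.eq_of_subset_of_card_le ?_ (by rw [Finset.card_smul_finset])
    intro y hy
    obtain ⟨x, hx, rfl⟩ := Finset.mem_smul_finset.1 hy
    obtain ⟨c, hc, hxc⟩ := Finset.mem_biUnion.1 hx
    refine Finset.mem_biUnion.2 ⟨c, hc, ?_⟩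
    obtain ⟨z, rfl⟩ := mem_cycleSets.1 (hS hc)
    rw [id, mem_cycleSet] at hxc ⊢
    exact sameCycle_apply_right.2 hxc
  · have key : ∀ S₁ ∈ σ.cycleSets.powerset, ∀ S₂ ∈ σ.cycleSets.powerset,
        S₁.biUnion id = S₂.biUnion id → S₁ ⊆ S₂ := by
      intro S₁ h₁ S₂ h₂ h c hc
      rw [Finset.mem_powerset] at h₁ h₂
      obtain ⟨x, rfl⟩ := mem_cycleSets.1 (h₁ hc)
      have hx : x ∈ S₁.biUnion id :=
        Finset.mem_biUnion.2 ⟨_, hc, mem_cycleSet.2 (SameCycle.refl _ _)⟩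
      rw [h] at hx
      obtain ⟨d, hd, hxd⟩ := Finset.mem_biUnion.1 hx
      obtain ⟨y, rfl⟩ := mem_cycleSets.1 (h₂ hd)
      rw [cycleSet_eq_of_mem hxd]
      exact hd
    intro S₁ h₁ S₂ h₂ h
    exact (key _ h₁ _ h₂ h).antisymm (key _ h₂ _ h₁ h.symm)
  · intro T hT
    rw [Finset.mem_filter] at hT
    refine ⟨{c ∈ σ.cycleSets | c ⊆ T}, Finset.mem_powerset.2 (Finset.filter_subset _ _), ?_⟩
    ext x
    rw [Finset.mem_biUnion]
    constructor
    · rintro ⟨c, hc, hx⟩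
      exact (Finset.mem_filter.1 hc).2 hx
    · intro hx
      exact ⟨σ.cycleSet x, Finset.mem_filter.2 ⟨mem_cycleSets.2 ⟨x, rfl⟩,
        cycleSet_subset_of_smul_eq hT.2 hx⟩, mem_cycleSet.2 (SameCycle.refl _ _)⟩
  · intro S hS
    rw [Finset.mem_powerset] at hS
    rw [Finset.prod_pow_eq_pow_sum, Finset.card_biUnion]
    · rfl
    · exact (pairwiseDisjoint_cycleSets σ).subset hS

open Polynomial in
theorem coeff_prod_one_add_X_pow_parts (σ : Perm α) (k : ℕ) :
    ((σ.partition.parts.map fun i => 1 + (X : ℤ[X]) ^ i).prod).coeff k =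
      ((Fintype.card (MulAction.fixedBy (Set.powersetCard α k) σ) : ℕ) : ℤ) := by
  rw [← sum_X_pow_card_invariant, finsetSum_coeff]
  simp_rw [coeff_X_pow]
  rw [Finset.sum_boole, Finset.filter_filter, Nat.cast_inj, ← Fintype.card_coe]
  refine Fintype.card_congr
    { toFun := fun T => ⟨⟨T.1, ((Finset.mem_filter.1 T.2).2.2).symm⟩,
        Subtype.ext (Finset.mem_filter.1 T.2).2.1⟩
      invFun := fun T => ⟨T.1.1, Finset.mem_filter.2 ⟨Finset.mem_univ _,
        congrArg Subtype.val T.2, T.1.2.symm⟩⟩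
      left_inv := fun T => rfl
      right_inv := fun T => rfl }

end Equiv.Perm

/-- The permutation representation on functions on a `G`-set. -/
def Representation.ofMulActionFun (G H : Type*) [Group G] [MulAction G H] :
    Representation ℂ G (H → ℂ) where
  toFun g := LinearMap.funLeft ℂ ℂ fun h : H => g⁻¹ • h
  map_one' := by
    ext
    simp [LinearMap.funLeft]
  map_mul' a b := by
    ext
    simp [LinearMap.funLeft, mul_smul]

theorem Representation.character_ofMulActionFun (G H : Type*) [Group G] [MulAction G H] [Fintype H]
    [DecidableEq H] (g : G) :
    (ofMulActionFun G H).character g = Fintype.card (MulAction.fixedBy H g) := by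
  rw [character, LinearMap.trace_eq_matrix_trace ℂ (Pi.basisFun ℂ H), Matrix.trace]
  have h : ∀ x : H, (LinearMap.toMatrix (Pi.basisFun ℂ H) (Pi.basisFun ℂ H)
      (ofMulActionFun G H g)).diag x = if g • x = x then 1 else 0 := by
    intro x
    have hx : g⁻¹ • x = x ↔ g • x = x := by rw [inv_smul_eq_iff, eq_comm]
    simp [ofMulActionFun, LinearMap.funLeft, Pi.single_apply, hx]
  simp_rw [h]
  rw [Finset.sum_boole, ← Fintype.card_subtype]
  rfl

/-! ### Powers of cycles, and part replacement inside the symmetric group -/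

namespace Equiv.Perm

variable {α : Type*} [Fintype α] [DecidableEq α]

/-- A power of a cycle that fixes one point of the support is trivial, so all cycles of `c ^ j` have
length equal to its order `d`. The filter covers `d = 1`, since `cycleType` omits fixed points. -/
theorem IsCycle.cycleType_pow {c : Perm α} (hc : c.IsCycle) {q d j : ℕ}
    (hN : c.support.card = q * d) (hg : (q * d).gcd j = q) :
    (c ^ j).cycleType = (Multiset.replicate q d).filter (2 ≤ ·) := by
  have hpos : 0 < q * d := hN ▸ (by have := hc.two_le_card_support; omega)
  have hq : 0 < q := Nat.pos_of_mul_pos_right hpos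
  have hd : 0 < d := Nat.pos_of_mul_pos_left hpos
  have ho : orderOf (c ^ j) = d := by
    rw [orderOf_pow, hc.orderOf, hN, hg, Nat.mul_div_cancel_left d hq]
  rcases Nat.lt_or_ge d 2 with hd2 | hd2
  · obtain rfl : d = 1 := by omega
    rw [orderOf_eq_one_iff.1 ho, cycleType_one, eq_comm, Multiset.filter_eq_nil]
    intro a ha
    rw [Multiset.eq_of_mem_replicate ha]
    decide
  · have hj : (c ^ j).support = c.support := by
      rw [hc.support_pow_eq_iff]
      intro h
      rw [orderOf_dvd_iff_pow_eq_one] at h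
      rw [h, orderOf_one] at ho
      omega
    have hall : ∀ l ∈ (c ^ j).cycleType, l = d := by
      intro l hl
      refine Nat.dvd_antisymm (ho ▸ dvd_of_mem_cycleType hl) ?_
      rw [cycleType_def, Multiset.mem_map] at hl
      obtain ⟨f, hf, rfl⟩ := hl
      have hfc := (mem_cycleFactorsFinset_iff.1 hf).1
      obtain ⟨x, hx⟩ := hfc.nonempty_support
      have hxc : c x ≠ x := by
        rw [← mem_support, ← hj]
        exact mem_cycleFactorsFinset_support_le hf hx
      rw [Function.comp_apply, ← ho, orderOf_dvd_iff_pow_eq_one, ← pow_mul,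
        hc.pow_eq_one_iff' hxc, pow_mul, ← cycleOf_pow_apply_self, ← cycle_is_cycleOf hx hf,
        ← hfc.orderOf, pow_orderOf_eq_one, one_apply]
    have hcard := sum_cycleType (c ^ j)
    rw [Multiset.eq_replicate_of_mem hall, Multiset.sum_replicate, hj, hN, smul_eq_mul] at hcard
    rw [Multiset.eq_replicate_of_mem hall, Nat.eq_of_mul_eq_mul_right hd hcard, eq_comm,
      Multiset.filter_eq_self]
    intro a ha
    rwa [Multiset.eq_of_mem_replicate ha]

theorem exists_partition_eq (ν : (Fintype.card α).Partition) : ∃ σ : Perm α, σ.partition = ν := by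
  have h1 : ν.parts.filter (2 ≤ ·) + ν.parts.filter (¬ 2 ≤ ·) = ν.parts :=
    Multiset.filter_add_not _ _
  have hall : ∀ l ∈ ν.parts.filter (¬ 2 ≤ ·), l = 1 := by
    intro l hl
    rw [Multiset.mem_filter] at hl
    have := ν.parts_pos hl.1
    omega
  have hs := congrArg Multiset.sum h1
  rw [Multiset.sum_add, ν.parts_sum] at hs
  obtain ⟨σ, hσ⟩ := (exists_with_cycleType_iff (α := α) (m := ν.parts.filter (2 ≤ ·))).2
    ⟨by omega, fun a ha => (Multiset.mem_filter.1 ha).2⟩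
  refine ⟨σ, Nat.Partition.ext ?_⟩
  rw [parts_partition, ← sum_cycleType, hσ]
  conv_rhs => rw [← h1]
  congr 1
  rw [Multiset.eq_replicate_of_mem hall] at hs ⊢
  rw [Multiset.sum_replicate, smul_eq_mul, mul_one] at hs
  congr 1
  omega

theorem groupPrimePowerRel_of_partsReplacement {p m : ℕ} (hp : p.Prime) (hm : 1 ≤ m)
    {σ τ : Perm α} (h : PartsReplacement p m σ.partition τ.partition) :
    GroupPrimePowerRel p m σ τ := by
  obtain ⟨ξ, k, hσ, hτ⟩ := h
  have hk : 0 < k := σ.partition.parts_pos (i := k) (by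
    rw [hσ, Multiset.mem_add, Multiset.mem_replicate]
    exact Or.inr ⟨(pow_pos hp.pos m).ne', rfl⟩)
  obtain ⟨a, k', hk', rfl⟩ := Nat.exists_eq_pow_mul_and_not_dvd hk.ne' p hp.ne_one
  have hk'0 : 0 < k' := Nat.pos_of_mul_pos_left hk
  have hcop : Nat.Coprime p k' := (Nat.Prime.coprime_iff_not_dvd hp).2 hk'
  have hpm : p ^ m = p ^ (m - 1) * p := by rw [← pow_succ, Nat.sub_add_cancel hm]
  have hN2 : 2 ≤ p ^ m * (p ^ a * k') := by
    refine le_trans ?_ (Nat.le_mul_of_pos_right _ hk)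
    exact hp.two_le.trans (Nat.le_self_pow (by omega) p)
  have hsum := σ.partition.parts_sum
  rw [hσ, Multiset.sum_add, Multiset.sum_replicate, smul_eq_mul] at hsum
  -- The parts to be replaced are merged into a single cycle `c` of length `p ^ m * k`; a disjoint
  -- `r` carries the parts `ξ`.
  obtain ⟨π, hπ⟩ := (exists_with_cycleType_iff (α := α)
    (m := {p ^ m * (p ^ a * k')} + ξ.filter (2 ≤ ·))).2 (by
      have h1 := congrArg Multiset.sum (Multiset.filter_add_not (2 ≤ ·) ξ)
      rw [Multiset.sum_add] at h1
      refine ⟨?_, fun b hb => ?_⟩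
      · rw [Multiset.sum_add, Multiset.sum_singleton]
        omega
      · rw [Multiset.mem_add, Multiset.mem_singleton, Multiset.mem_filter] at hb
        rcases hb with rfl | hb
        exacts [hN2, hb.2])
  obtain ⟨c, r, rfl, hdis, hc, hcard⟩ := mem_cycleType_iff.1
    (show p ^ m * (p ^ a * k') ∈ π.cycleType by rw [hπ]; simp)
  rw [hdis.cycleType_mul, hc.cycleType, hcard, add_right_inj] at hπ
  have hpow : ∀ j, (r * c ^ j).cycleType = ξ.filter (2 ≤ ·) + (c ^ j).cycleType := by
    intro j
    rw [Disjoint.cycleType_mul, hπ]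
    have := (hdis.pow_disjoint_pow j 1).symm
    rwa [pow_one] at this
  have e1 : (c ^ p ^ m).cycleType = (Multiset.replicate (p ^ m) (p ^ a * k')).filter (2 ≤ ·) :=
    hc.cycleType_pow hcard (Nat.gcd_eq_right (dvd_mul_right _ _))
  have e2 : (c ^ (p ^ m + k' * p ^ (m - 1))).cycleType =
      (Multiset.replicate (p ^ (m - 1)) (p ^ a * k' * p)).filter (2 ≤ ·) := by
    refine hc.cycleType_pow (by rw [hcard, hpm]; ring) ?_
    -- The cofactor `p + k'` is coprime to both `p` and `k'`, so the gcd with the cycle length is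
    -- exactly `p ^ (m - 1)`.
    have h1 : p ^ m + k' * p ^ (m - 1) = p ^ (m - 1) * (p + k') := by rw [hpm]; ring
    have hcp : Nat.Coprime p (p + k') := by simpa using hcop
    have hck : Nat.Coprime k' (p + k') := by simpa using hcop.symm
    rw [h1, Nat.gcd_mul_left, Nat.Coprime.gcd_eq_one, mul_one]
    exact ((hcp.pow_left a).mul_left hck).mul_left hcp
  have c1 : IsConj σ (r * c ^ p ^ m) := by
    rw [isConj_iff_cycleType_eq, hpow, e1, ← filter_parts_partition_eq_cycleType, hσ,
      Multiset.filter_add]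
  have c2 : IsConj (r * c ^ p ^ m * (c ^ k') ^ p ^ (m - 1)) τ := by
    rw [mul_assoc, ← pow_mul, ← pow_add, isConj_iff_cycleType_eq, hpow, e2,
      ← filter_parts_partition_eq_cycleType, hτ, Multiset.filter_add]
  have hcomm : Commute (c ^ k') (r * c ^ p ^ m) :=
    (hdis.commute.pow_left k').mul_right (Commute.pow_pow_self c _ _)
  have hord : orderOf (c ^ k') = p ^ (m + a) := by
    rw [orderOf_pow, hc.orderOf, hcard, ← mul_assoc, ← pow_add, Nat.gcd_mul_left_left,
      Nat.mul_div_cancel _ hk'0]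
  have step : GroupPrimePowerRel p m (r * c ^ p ^ m) (r * c ^ p ^ m * (c ^ k') ^ p ^ (m - 1)) :=
    Relation.EqvGen.rel _ _ (Or.inr ⟨c ^ k', hcomm, ⟨m + a, hord⟩, rfl⟩)
  exact Relation.EqvGen.trans _ _ _ (Relation.EqvGen.rel _ _ (Or.inl c1))
    (Relation.EqvGen.trans _ _ _ step (Relation.EqvGen.rel _ _ (Or.inl c2)))

theorem groupPrimePowerRel_of_partitionCombRel {p m : ℕ} (hp : p.Prime) (hm : 1 ≤ m)
    {σ τ : Perm α} (h : PartitionCombRel p m σ.partition τ.partition) :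
    GroupPrimePowerRel p m σ τ := by
  -- The induction runs over partitions; the intermediate one in a transitivity step is realised by
  -- some permutation.
  suffices H : ∀ ν μ : (Fintype.card α).Partition, PartitionCombRel p m ν μ →
      ∀ σ τ : Perm α, σ.partition = ν → τ.partition = μ → GroupPrimePowerRel p m σ τ from
    H _ _ h σ τ rfl rfl
  intro ν μ h
  induction h with
  | rel ν μ h =>
    rintro σ τ rfl rfl
    exact groupPrimePowerRel_of_partsReplacement hp hm h
  | refl ν =>
    rintro σ τ h1 h2
    exact Relation.EqvGen.rel _ _ (Or.inl (partition_eq_of_isConj.2 (h1.trans h2.symm)))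
  | symm ν μ _ ih =>
    intro σ τ h1 h2
    exact (ih τ σ h2 h1).symm
  | trans ν κ μ _ _ ih1 ih2 =>
    intro σ τ h1 h2
    obtain ⟨π, hπ⟩ := exists_partition_eq κ
    exact (ih1 σ π h1 hπ).trans _ _ _ (ih2 π τ hπ h2)

end Equiv.Perm

/-! ### From the group relation to character congruences -/

theorem IntCongruentMod.symm {N : ℕ} {z w : ℂ} (h : IntCongruentMod N z w) :
    IntCongruentMod N w z := by
  obtain ⟨a, b, ha, hb, hab⟩ := h
  exact ⟨b, a, hb, ha, hab.symm⟩

theorem IntCongruentMod.trans {N : ℕ} {z w v : ℂ} (h : IntCongruentMod N z w)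
    (h' : IntCongruentMod N w v) : IntCongruentMod N z v := by
  obtain ⟨a, b, ha, hb, hab⟩ := h
  obtain ⟨b', c, hb', hc, hbc⟩ := h'
  obtain rfl : b = b' := Int.cast_injective (hb.symm.trans hb')
  exact ⟨a, c, ha, hc, hab.trans hbc⟩

theorem Equiv.Perm.character_pow_of_coprime {α V : Type*} [Finite α] [AddCommGroup V] [Module ℂ V]
    (ρ : Representation ℂ (Equiv.Perm α) V) (g : Equiv.Perm α) (u : ℕ)
    (hu : (orderOf g).Coprime u) : ρ.character (g ^ u) = ρ.character g := by
  classical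
  have : Fintype α := Fintype.ofFinite α
  obtain ⟨c, hc⟩ := isConj_iff.1 (isConj_pow_of_coprime hu)
  rw [← Representation.char_conj ρ (g ^ u) c, hc]

theorem Equiv.Perm.intCongruentMod_character_of_groupPrimePowerRel {α V : Type*} [Finite α]
    [AddCommGroup V] [Module ℂ V] [FiniteDimensional ℂ V]
    (ρ : Representation ℂ (Equiv.Perm α) V) {p m : ℕ} (hp : p.Prime) (hm : 1 ≤ m)
    {σ τ : Equiv.Perm α} (h : GroupPrimePowerRel p m σ τ) :
    IntCongruentMod (p ^ m) (ρ.character σ) (ρ.character τ) := by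
  -- Reflexivity contains the integrality of the values; it is the case of the trivial commuting
  -- element.
  have hrefl : ∀ g, IntCongruentMod (p ^ m) (ρ.character g) (ρ.character g) := by
    intro g
    have := ρ.intCongruentMod_character_mul_pow (character_pow_of_coprime ρ) (a := 0) hp hm
      (Commute.one_right g) (one_pow _)
    rwa [one_pow, mul_one] at this
  induction h with
  | rel x y h =>
    rcases h with h | ⟨h, hx, ⟨a, ha⟩, rfl⟩
    · obtain ⟨c, rfl⟩ := isConj_iff.1 h
      rw [Representation.char_conj]
      exact hrefl x
    · exact ρ.intCongruentMod_character_mul_pow (character_pow_of_coprime ρ) hp hm hx.symm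
        (ha ▸ pow_orderOf_eq_one h)
  | refl x => exact hrefl x
  | symm x y _ ih => exact ih.symm
  | trans x y z _ _ ih1 ih2 => exact ih1.trans ih2

/-! ### Reduced partitions and their recovery from generating functions -/

/-- Every partition is related to one in which each part occurs fewer than `p ^ m` times. -/
theorem exists_partitionCombRel_count_lt {p m : ℕ} (hp : p.Prime) (hm : 1 ≤ m) {N : ℕ}
    (ν : N.Partition) :
    ∃ μ : N.Partition, PartitionCombRel p m ν μ ∧ ∀ k, μ.parts.count k < p ^ m := by
  -- A replacement lowers the number of parts, since `p ^ (m - 1) < p ^ m`.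
  induction hn : Multiset.card ν.parts using Nat.strong_induction_on generalizing ν with
  | _ n ih =>
  by_cases hν : ∀ k, ν.parts.count k < p ^ m
  · exact ⟨ν, Relation.EqvGen.refl _, hν⟩
  push Not at hν
  obtain ⟨k, hk⟩ := hν
  have hpm : p ^ m = p ^ (m - 1) * p := by rw [← pow_succ, Nat.sub_add_cancel hm]
  have hlt : p ^ (m - 1) < p ^ m := Nat.pow_lt_pow_right hp.one_lt (by omega)
  have hk0 : 0 < k := ν.parts_pos (Multiset.count_pos.1 ((pow_pos hp.pos m).trans_le hk))
  obtain ⟨ξ, hξ⟩ := Multiset.le_iff_exists_add.1 (Multiset.le_count_iff_replicate_le.1 hk)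
  rw [add_comm] at hξ
  let κ : N.Partition :=
    { parts := ξ + Multiset.replicate (p ^ (m - 1)) (k * p)
      parts_pos := fun {i} hi => by
        rcases Multiset.mem_add.1 hi with hi | hi
        · exact ν.parts_pos (hξ ▸ Multiset.mem_add.2 (Or.inl hi))
        · rw [Multiset.eq_of_mem_replicate hi]
          exact Nat.mul_pos hk0 hp.pos
      parts_sum := by
        have h := ν.parts_sum
        rw [hξ, Multiset.sum_add, Multiset.sum_replicate, smul_eq_mul, hpm] at h
        rw [Multiset.sum_add, Multiset.sum_replicate, smul_eq_mul, ← h]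
        ring }
  have hκ : Multiset.card κ.parts < n := by
    rw [← hn, hξ]
    simpa [κ] using hlt
  obtain ⟨μ, h1, h2⟩ := ih _ hκ κ rfl
  exact ⟨μ, (Relation.EqvGen.rel _ _ ⟨ξ, k, hξ, rfl⟩).trans _ _ _ h1, h2⟩

section GeneratingFunction

open Polynomial

theorem X_pow_succ_dvd_prod_one_add_X_pow_sub {k : ℕ} (hk : 0 < k) (s : Multiset ℕ)
    (hs : ∀ i ∈ s, k ≤ i) :
    (X : ℤ[X]) ^ (k + 1) ∣
      (s.map fun i => 1 + (X : ℤ[X]) ^ i).prod - (1 + (s.count k : ℤ[X]) * X ^ k) := by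
  induction s using Multiset.induction_on with
  | empty => simp
  | cons i s ih =>
    obtain ⟨Q, hQ⟩ := ih fun j hj => hs j (Multiset.mem_cons_of_mem hj)
    rw [sub_eq_iff_eq_add] at hQ
    rw [Multiset.map_cons, Multiset.prod_cons, hQ]
    rcases (hs i (Multiset.mem_cons_self i s)).eq_or_lt with rfl | hi
    · obtain ⟨l, rfl⟩ : ∃ l, k = l + 1 := ⟨k - 1, by omega⟩
      rw [Multiset.count_cons_self]
      refine ⟨Q + X ^ (l + 1) * Q + (s.count (l + 1) : ℤ[X]) * X ^ l, ?_⟩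
      push_cast
      ring
    · obtain ⟨l, rfl⟩ := Nat.exists_eq_add_of_lt hi
      rw [Multiset.count_cons_of_ne (by omega)]
      refine ⟨Q + X ^ l * (X ^ (k + 1) * Q + (1 + (s.count k : ℤ[X]) * X ^ k)), ?_⟩
      ring

/-- Parts larger than `k` do not matter modulo `X ^ (k + 1)`, and parts equal to `k` contribute `1 +
count * X ^ k`. The product over the smaller parts has constant term `1`, so the multiplicity of `k`
enters with coefficient `1`. -/
theorem coeff_prod_one_add_X_pow {k : ℕ} (hk : 0 < k) (s : Multiset ℕ) (hs : ∀ i ∈ s, 0 < i) :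
    ((s.map fun i => 1 + (X : ℤ[X]) ^ i).prod).coeff k =
      (((s.filter (· < k)).map fun i => 1 + (X : ℤ[X]) ^ i).prod).coeff k +
        ((s.count k : ℕ) : ℤ) := by
  obtain ⟨Q, hQ⟩ := X_pow_succ_dvd_prod_one_add_X_pow_sub hk (s.filter fun i => ¬ i < k)
    (fun i hi => not_lt.1 (Multiset.mem_filter.1 hi).2)
  rw [Multiset.count_filter_of_pos (p := fun i => ¬ i < k) (lt_irrefl k), sub_eq_iff_eq_add] at hQ
  have h0 : (((s.filter (· < k)).map fun i => 1 + (X : ℤ[X]) ^ i).prod).coeff 0 = 1 := by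
    rw [coeff_zero_eq_eval_zero, eval_multiset_prod, Multiset.map_map]
    refine Multiset.prod_eq_one fun x hx => ?_
    obtain ⟨i, hi, rfl⟩ := Multiset.mem_map.1 hx
    simp [(hs i (Multiset.mem_filter.1 hi).1).ne']
  have hsplit := Multiset.filter_add_not (· < k) s
  conv_lhs => rw [← hsplit]
  rw [Multiset.map_add, Multiset.prod_add, hQ]
  set A := ((s.filter (· < k)).map fun i => 1 + (X : ℤ[X]) ^ i).prod
  have : A * (X ^ (k + 1) * Q + (1 + (s.count k : ℤ[X]) * X ^ k)) =
      A * Q * X ^ (k + 1) + A + C (s.count k : ℤ) * A * X ^ k := by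
    rw [← C_eq_natCast]
    ring
  rw [this, coeff_add, coeff_add, coeff_mul_X_pow', if_neg (by omega), coeff_mul_X_pow',
    if_pos le_rfl, Nat.sub_self, coeff_C_mul, h0, zero_add, mul_one]

end GeneratingFunction

/-- Once the multiplicities below `k` agree, the coefficients of `X ^ k` give a congruence between
the multiplicities of `k`, which is an equality because both are below `N`. -/
theorem Multiset.eq_of_coeff_prod_one_add_X_pow_modEq {N : ℕ} {s t : Multiset ℕ}
    (hs : ∀ i ∈ s, 0 < i) (ht : ∀ i ∈ t, 0 < i) (hsN : ∀ k, s.count k < N)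
    (htN : ∀ k, t.count k < N)
    (h : ∀ k, ((s.map fun i => 1 + (Polynomial.X : Polynomial ℤ) ^ i).prod).coeff k ≡
      ((t.map fun i => 1 + (Polynomial.X : Polynomial ℤ) ^ i).prod).coeff k [ZMOD N]) :
    s = t := by
  ext k
  induction k using Nat.strong_induction_on with
  | _ k ih =>
  rcases Nat.eq_zero_or_pos k with rfl | hk
  · rw [Multiset.count_eq_zero.2 fun h => lt_irrefl 0 (hs 0 h),
      Multiset.count_eq_zero.2 fun h => lt_irrefl 0 (ht 0 h)]
  · have hf : s.filter (· < k) = t.filter (· < k) := by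
      ext j
      rw [Multiset.count_filter, Multiset.count_filter]
      split_ifs with hj
      exacts [ih j hj, rfl]
    have hk' := h k
    rw [coeff_prod_one_add_X_pow hk s hs, coeff_prod_one_add_X_pow hk t ht, hf] at hk'
    exact Nat.ModEq.eq_of_lt_of_lt (Int.natCast_modEq_iff.1 (Int.ModEq.add_left_cancel' _ hk'))
      (hsN k) (htN k)

theorem Equiv.Perm.partition_eq_of_intCongruentMod {n N : ℕ} {σ τ : Equiv.Perm (Fin n)}
    (hσ : ∀ k, σ.partition.parts.count k < N) (hτ : ∀ k, τ.partition.parts.count k < N)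
    (h : ∀ χ : Equiv.Perm (Fin n) → ℂ, IsComplexCharacter χ → IntCongruentMod N (χ σ) (χ τ)) :
    σ.partition = τ.partition := by
  refine Nat.Partition.ext (Multiset.eq_of_coeff_prod_one_add_X_pow_modEq
    (fun i hi => σ.partition.parts_pos hi) (fun i hi => τ.partition.parts_pos hi) hσ hτ fun k => ?_)
  rw [coeff_prod_one_add_X_pow_parts, coeff_prod_one_add_X_pow_parts]
  obtain ⟨a, b, ha, hb, hab⟩ := h
    (Representation.ofMulActionFun (Equiv.Perm (Fin n)) (Set.powersetCard (Fin n) k)).character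
    ⟨_, _, _, inferInstance, _, rfl⟩
  rw [Representation.character_ofMulActionFun, ← Int.cast_natCast, Int.cast_inj] at ha hb
  rwa [ha, hb]

theorem proposition4p2 (p : ℕ) (hp : p.Prime) (m : ℕ) (hm : 1 ≤ m) (n : ℕ)
    (σ σ' : Equiv.Perm (Fin n)) :
    List.TFAE
      [PermCombRel p m σ σ',
       GroupPrimePowerRel p m σ σ',
       ∀ χ : Equiv.Perm (Fin n) → ℂ, IsComplexCharacter χ →
         IntCongruentMod (p ^ m) (χ σ) (χ σ')] := by
  have h12 : ∀ {σ σ' : Equiv.Perm (Fin n)}, PermCombRel p m σ σ' → GroupPrimePowerRel p m σ σ' :=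
    Equiv.Perm.groupPrimePowerRel_of_partitionCombRel hp hm
  have h23 : ∀ {σ σ' : Equiv.Perm (Fin n)}, GroupPrimePowerRel p m σ σ' →
      ∀ χ : Equiv.Perm (Fin n) → ℂ, IsComplexCharacter χ →
        IntCongruentMod (p ^ m) (χ σ) (χ σ') := by
    rintro σ σ' h _ ⟨V, _, _, _, ρ, rfl⟩
    exact Equiv.Perm.intCongruentMod_character_of_groupPrimePowerRel ρ hp hm h
  tfae_have 1 → 2 := h12
  tfae_have 2 → 3 := h23
  tfae_have 3 → 1 := by
    intro h
    obtain ⟨μ, h1, hμ⟩ := exists_partitionCombRel_count_lt hp hm σ.partition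
    obtain ⟨μ', h1', hμ'⟩ := exists_partitionCombRel_count_lt hp hm σ'.partition
    obtain ⟨τ, rfl⟩ := Equiv.Perm.exists_partition_eq μ
    obtain ⟨τ', rfl⟩ := Equiv.Perm.exists_partition_eq μ'
    -- The reductions preserve character values modulo `p ^ m` by the implications already proved,
    -- so the congruence passes to the reduced permutations.
    have he : τ.partition = τ'.partition :=
      Equiv.Perm.partition_eq_of_intCongruentMod hμ hμ' fun χ hχ =>
        (h23 (h12 h1) χ hχ).symm.trans ((h χ hχ).trans (h23 (h12 h1') χ hχ))
    rw [he] at h1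
    exact h1.trans _ _ _ h1'.symm
  tfae_finish
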